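/- Let $n\ge 1$ and $q\ge 0$ be integers, and let $(M_1,\mathcal F_1,g_1)$, $(M_2,\mathcal F_2,g_2)$ be compact smooth $n$-dimensional Riemannian manifolds, possibly with boundary, carrying foliations of codimension $q$ that are tangent to the boundary (every leaf meeting $\partial M_i$ is contained in $\partial M_i$). Let $S_i\subset\partial M_i$ be a union of connected components of $\partial M_i$, and let $h\colon S_1\to S_2$ be an isometry (with respect to the Riemannian structures induced on $S_1$, $S_2$) mapping leaves onto leaves. Let $M=M_1\cup_h M_2$ be the quotient of $M_1\sqcup M_2$ under the identification $x\equiv h(x)$, $x\in S_1$, and let $\mathcal F$ be the glued foliation of $M$, whose leaves are the images of the leaves of $\mathcal F_1$ and $\mathcal F_2$. Assume that $M$ carries a smooth structure and a smooth Riemannian metric $g$ such that the natural maps $M_i\to M$ are smooth and $g|_{M_i}=g_i$ for $i=1,2$. For a foliation $\mathcal G$ of a compact Riemannian manifold $N$ and leaves $L,L'$ put $\rho(L,L')=\inf\sum_{i=1}^{k-1}\operatorname{dist}(L_i,L_{i+1})$, the infimum being taken over all finite sequences of leaves $L=L_1,\dots,L_k=L'$ (points in different components of $N$ are at distance $\infty$).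 The Hausdorff leaf space $\mathrm{HLS}(\mathcal G)$ is the set of leaves modulo the relation $\rho(L,L')=0$, with the metric induced by $\rho$; let $\pi_i\colon M_i\to \mathrm{HLS}(\mathcal F_i)$ be the natural projections, sending a point to the class of its leaf. Equip $\mathrm{HLS}(\mathcal F_1)\sqcup \mathrm{HLS}(\mathcal F_2)$ with the disjoint union metric (points of different pieces are at distance $\infty$), and let $\sim$ be the smallest equivalence relation on it such that $\pi_1(x)\sim\pi_2(h(x))$ for all $x\in S_1$. Let $(X,d_X)$ be the quotient metric space: the set of equivalence classes with the pseudo-metric $\inf\sum_{j=1}^k d(p_j,q_j)$, the infimum being over all $p_1,q_1,\dots,p_k,q_k$ with $p_1$ in the first class, $q_k$ in the second class and $q_j\sim p_{j+1}$, after identification of classes at distance zero. Then $\mathrm{HLS}(\mathcal F)$ is isometric to $(X,d_X)$. -/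

import Mathlib

open Bundle Manifold
open scoped ContDiff Topology ENNReal

noncomputable section

universe u v

/-! ## Quotient metric spaces -/

section MetricQuotient

variable {α : Type u}

/-- The distance between two equivalence classes, as subsets: the infimum of the distances between
their points. -/
def classEDist (d : α → α → ℝ≥0∞) (s : Setoid α) (A B : Quotient s) : ℝ≥0∞ :=
  ⨅ (p : α) (q : α) (_ : Quotient.mk s p = A) (_ : Quotient.mk s q = B), d p q

/-- The infimum of `∑ i < k, dist (L i, L (i + 1))` over all finite sequences of classes
`L 0, …, L k` beginning at `A` and ending at `B`. -/
def chainEDist (d : α → α → ℝ≥0∞) (s : Setoid α) (A B : Quotient s) : ℝ≥0∞ :=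
  ⨅ (k : ℕ) (L : ℕ → Quotient s) (_ : L 0 = A) (_ : L k = B),
    ∑ i ∈ Finset.range k, classEDist d s (L i) (L (i + 1))

theorem classEDist_comm {d : α → α → ℝ≥0∞} (hd : ∀ x y, d x y = d y x) (s : Setoid α)
    (A B : Quotient s) : classEDist d s A B = classEDist d s B A := by
  have key : ∀ A B : Quotient s, classEDist d s A B ≤ classEDist d s B A := by
    intro A B
    refine le_iInf fun p => le_iInf fun q => le_iInf fun hp => le_iInf fun hq => ?_
    rw [hd p q]
    exact iInf_le_of_le q (iInf_le_of_le p (iInf_le_of_le hq (iInf_le_of_le hp le_rfl)))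
  exact le_antisymm (key A B) (key B A)

theorem chainEDist_le {d : α → α → ℝ≥0∞} {s : Setoid α} {A B : Quotient s} (k : ℕ)
    (L : ℕ → Quotient s) (h0 : L 0 = A) (hk : L k = B) :
    chainEDist d s A B ≤ ∑ i ∈ Finset.range k, classEDist d s (L i) (L (i + 1)) :=
  iInf_le_of_le k (iInf_le_of_le L (iInf_le_of_le h0 (iInf_le_of_le hk le_rfl)))

theorem chainEDist_self (d : α → α → ℝ≥0∞) (s : Setoid α) (A : Quotient s) :
    chainEDist d s A A = 0 := by
  have h := chainEDist_le (d := d) (s := s) 0 (fun _ => A) rfl rfl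
  simpa using h

theorem chainEDist_comm {d : α → α → ℝ≥0∞} (hd : ∀ x y, d x y = d y x) (s : Setoid α)
    (A B : Quotient s) : chainEDist d s A B = chainEDist d s B A := by
  have key : ∀ A B : Quotient s, chainEDist d s A B ≤ chainEDist d s B A := by
    intro A B
    refine le_iInf fun k => le_iInf fun L => le_iInf fun h0 => le_iInf fun hk => ?_
    refine (chainEDist_le k (fun i => L (k - i)) (by simpa using hk) (by simpa using h0)).trans ?_
    rw [← Finset.sum_range_reflect]
    refine Finset.sum_le_sum fun i hi => ?_
    have hi' := Finset.mem_range.1 hi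
    have e1 : k - (k - 1 - i) = i + 1 := by omega
    have e2 : k - (k - 1 - i + 1) = i := by omega
    simp only [e1, e2]
    exact (classEDist_comm hd s _ _).le
  exact le_antisymm (key A B) (key B A)

theorem chainEDist_triangle (d : α → α → ℝ≥0∞) (s : Setoid α) (A B C : Quotient s) :
    chainEDist d s A C ≤ chainEDist d s A B + chainEDist d s B C := by
  have key : ∀ (k l : ℕ) (L L' : ℕ → Quotient s), L 0 = A → L k = B → L' 0 = B → L' l = C →
      chainEDist d s A C ≤ (∑ i ∈ Finset.range k, classEDist d s (L i) (L (i + 1))) +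
        ∑ i ∈ Finset.range l, classEDist d s (L' i) (L' (i + 1)) := by
    intro k l L L' h0 hk h0' hl
    refine (chainEDist_le (k + l) (fun i => if i ≤ k then L i else L' (i - k)) (by simpa using h0)
      ?_).trans ?_
    · rcases Nat.eq_zero_or_pos l with rfl | hl0
      · simp [hk, ← hl, h0']
      · simp [hl0.ne', hl]
    · rw [Finset.sum_range_add]
      refine add_le_add (Finset.sum_le_sum fun i hi => ?_) (Finset.sum_le_sum fun i _ => ?_)
      · have hi' := Finset.mem_range.1 hi
        simp [hi'.le, Nat.succ_le_of_lt hi']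
      · have e1 : ¬ (k + i + 1 ≤ k) := by omega
        have e2 : k + i + 1 - k = i + 1 := by omega
        rcases Nat.eq_zero_or_pos i with rfl | hi0
        · simp [hk, h0']
        · have e3 : ¬ (k + i ≤ k) := by omega
          simp [e1, e2, hi0.ne']
  simp only [chainEDist, ENNReal.iInf_add, ENNReal.add_iInf]
  refine le_iInf fun l => le_iInf fun L' => le_iInf fun h0' => le_iInf fun hl =>
    le_iInf fun k => le_iInf fun L => le_iInf fun h0 => le_iInf fun hk => ?_
  exact key _ _ _ _ h0 hk h0' hl

/-- The set of classes of `s`, carrying the pseudo-metric `chainEDist`. -/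
def PreMetricQuotient (d : α → α → ℝ≥0∞) (_hd : ∀ x y, d x y = d y x) (s : Setoid α) : Type u :=
  Quotient s

instance PreMetricQuotient.instPseudoEMetricSpace (d : α → α → ℝ≥0∞)
    (hd : ∀ x y, d x y = d y x) (s : Setoid α) :
    PseudoEMetricSpace (PreMetricQuotient d hd s) where
  edist := chainEDist d s
  edist_self := chainEDist_self d s
  edist_comm := chainEDist_comm hd s
  edist_triangle := chainEDist_triangle d s

/-- The quotient metric space of `(α, d)` by the equivalence relation `s`: the set of classes with
the quotient pseudo-metric, after identification of the classes at distance zero. -/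
def MetricQuotient (d : α → α → ℝ≥0∞) (hd : ∀ x y, d x y = d y x) (s : Setoid α) : Type u :=
  SeparationQuotient (PreMetricQuotient d hd s)

instance MetricQuotient.instEMetricSpace (d : α → α → ℝ≥0∞)
    (hd : ∀ x y, d x y = d y x) (s : Setoid α) : EMetricSpace (MetricQuotient d hd s) :=
  inferInstanceAs (EMetricSpace (SeparationQuotient (PreMetricQuotient d hd s)))

/-- The natural projection to the quotient metric space. -/
def MetricQuotient.proj (d : α → α → ℝ≥0∞) (hd : ∀ x y, d x y = d y x) (s : Setoid α) (x : α) :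
    MetricQuotient d hd s :=
  SeparationQuotient.mk (X := PreMetricQuotient d hd s) (Quotient.mk s x)

theorem MetricQuotient.edist_proj (d : α → α → ℝ≥0∞) (hd : ∀ x y, d x y = d y x) (s : Setoid α)
    (x y : α) : edist (MetricQuotient.proj d hd s x) (MetricQuotient.proj d hd s y) =
      chainEDist d s (Quotient.mk s x) (Quotient.mk s y) :=
  rfl

/-- The metric of the disjoint union: points of different pieces are at distance `∞`. -/
def sumEDist (X : Type u) (Y : Type v) [EDist X] [EDist Y] : X ⊕ Y → X ⊕ Y → ℝ≥0∞
  | Sum.inl x, Sum.inl x' => edist x x'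
  | Sum.inr y, Sum.inr y' => edist y y'
  | _, _ => ⊤

theorem sumEDist_comm (X : Type u) (Y : Type v) [PseudoEMetricSpace X] [PseudoEMetricSpace Y]
    (a b : X ⊕ Y) : sumEDist X Y a b = sumEDist X Y b a := by
  rcases a with a | a <;> rcases b with b | b <;> simp [sumEDist, edist_comm]

end MetricQuotient

/-! ## Foliations on manifolds with boundary -/

/-- The local leaf through `x` (its plaque) in a chart `e` whose coordinates with index in `T` are
the transverse ones: the connected component of `x` in the slice of the chart domain on which all
transverse coordinates have the same value as at `x`. -/
def plaque {n : ℕ} [NeZero n] {M : Type u} [TopologicalSpace M]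
    (e : OpenPartialHomeomorph M (EuclideanHalfSpace n)) (T : Finset (Fin n)) (x : M) : Set M :=
  connectedComponentIn {y | y ∈ e.source ∧ ∀ i ∈ T, (e y).1 i = (e x).1 i} x

/-- A `C^r` foliation of codimension `q` on an `n`-dimensional manifold with boundary `M`, given by
an atlas of foliated charts. A foliated chart is a `C^r` chart of `M` with values in the half-space
`{x | 0 ≤ x 0}`, together with a set `T` of `q` transverse coordinates; the other coordinates are
the ones along the leaves. (Near the boundary, `0 ∈ T` is the tangential and `0 ∉ T` is the
transverse situation.) The charts are coherent: locally in the overlap of two of them, the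
slices with constant transverse coordinates are the same. -/
structure Foliation (n : ℕ) [NeZero n] (q : ℕ) (r : WithTop ℕ∞) (M : Type u) [TopologicalSpace M]
    [ChartedSpace (EuclideanHalfSpace n) M] where
  charts : Set (OpenPartialHomeomorph M (EuclideanHalfSpace n) × Finset (Fin n))
  mem_maximalAtlas : ∀ c ∈ charts, c.1 ∈ IsManifold.maximalAtlas (𝓡∂ n) r M
  card_transverse : ∀ c ∈ charts, c.2.card = q
  exists_chart : ∀ x : M, ∃ c ∈ charts, x ∈ c.1.source
  coherent : ∀ c ∈ charts, ∀ c' ∈ charts, ∀ x ∈ c.1.source ∩ c'.1.source,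
    ∃ U ∈ 𝓝 x, U ⊆ c.1.source ∩ c'.1.source ∧ ∀ y ∈ U, ∀ z ∈ U,
      ((∀ i ∈ c.2, (c.1 y).1 i = (c.1 z).1 i) ↔ (∀ i ∈ c'.2, (c'.1 y).1 i = (c'.1 z).1 i))

namespace Foliation

variable {n : ℕ} [NeZero n] {q : ℕ} {r : WithTop ℕ∞} {M : Type u} [TopologicalSpace M]
  [ChartedSpace (EuclideanHalfSpace n) M]

/-- Two points lie in the same leaf iff they are joined by a finite chain of plaques. -/
def leafSetoid (F : Foliation n q r M) : Setoid M :=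
  Relation.EqvGen.setoid fun x y => ∃ c ∈ F.charts, x ∈ c.1.source ∧ y ∈ plaque c.1 c.2 x

/-- The leaf through `x`. -/
def leaf (F : Foliation n q r M) (x : M) : Set M :=
  {y | F.leafSetoid x y}

/-- The foliation is tangent to the boundary: every leaf that meets the boundary is contained
in it. -/
def IsTangentToBoundary (F : Foliation n q r M) : Prop :=
  ∀ x ∈ (𝓡∂ n).boundary M, F.leaf x ⊆ (𝓡∂ n).boundary M

variable [RiemannianBundle (fun x : M => TangentSpace (𝓡∂ n) x)]

/-- The Hausdorff leaf space: the set of leaves with the pseudo-metric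
`ρ (L, L') = inf ∑ dist (L_i, L_{i+1})` (infimum over finite sequences of leaves from `L` to `L'`,
with `dist` the Riemannian distance of `M` between leaves), after identification of the leaves
with `ρ (L, L') = 0`. -/
def HLS (F : Foliation n q r M) : Type u :=
  MetricQuotient (fun x y : M => riemannianEDist (𝓡∂ n) x y)
    (fun _ _ => Manifold.riemannianEDist_comm) F.leafSetoid

instance instEMetricSpaceHLS (F : Foliation n q r M) : EMetricSpace F.HLS :=
  inferInstanceAs (EMetricSpace (MetricQuotient _ _ _))

/-- The natural projection, sending a point to the class of its leaf. -/
def toHLS (F : Foliation n q r M) (x : M) : F.HLS :=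
  MetricQuotient.proj _ _ _ x

end Foliation

/-! ## Gluing -/

/-- `S` is a union of connected components of the boundary of `M`. -/
def IsUnionOfBoundaryComponents (n : ℕ) [NeZero n] {M : Type u} [TopologicalSpace M]
    [ChartedSpace (EuclideanHalfSpace n) M] (S : Set M) : Prop :=
  S ⊆ (𝓡∂ n).boundary M ∧ ∀ x ∈ S, connectedComponentIn ((𝓡∂ n).boundary M) x ⊆ S

/-- The intrinsic Riemannian distance of a submanifold `S` of `M` with the induced metric: the
infimum of the lengths of the `C^1` paths contained in `S`. -/
def intrinsicEDist (n : ℕ) [NeZero n] {M : Type u} [TopologicalSpace M]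
    [ChartedSpace (EuclideanHalfSpace n) M]
    [RiemannianBundle (fun x : M => TangentSpace (𝓡∂ n) x)] (S : Set M) (x y : S) : ℝ≥0∞ :=
  ⨅ (γ : Path (x : M) (y : M)) (_ : ContMDiff (𝓡∂ 1) (𝓡∂ n) 1 γ) (_ : ∀ t, γ t ∈ S),
    ∫⁻ t, ‖mfderiv (𝓡∂ 1) (𝓡∂ n) γ t 1‖ₑ

section Glued

variable {M₁ : Type u} {M₂ : Type v} [TopologicalSpace M₁] [TopologicalSpace M₂]
  {S₁ : Set M₁} {S₂ : Set M₂}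

/-- The equivalence relation on `M₁ ⊔ M₂` generated by `x ≡ h x` for `x ∈ S₁`. -/
def gluingSetoid (h : S₁ ≃ₜ S₂) : Setoid (M₁ ⊕ M₂) :=
  Relation.EqvGen.setoid fun a b => ∃ x : S₁, a = Sum.inl (x : M₁) ∧ b = Sum.inr (h x : M₂)

/-- The space `M₁ ∪_h M₂`, with the quotient topology. -/
def Glued (h : S₁ ≃ₜ S₂) : Type (max u v) :=
  Quotient (gluingSetoid h)

instance Glued.instTopologicalSpace (h : S₁ ≃ₜ S₂) : TopologicalSpace (Glued h) :=
  inferInstanceAs (TopologicalSpace (Quotient (gluingSetoid h)))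

/-- The natural map `M₁ → M₁ ∪_h M₂`. -/
def Glued.inl (h : S₁ ≃ₜ S₂) (x : M₁) : Glued h :=
  Quotient.mk (gluingSetoid h) (Sum.inl x)

/-- The natural map `M₂ → M₁ ∪_h M₂`. -/
def Glued.inr (h : S₁ ≃ₜ S₂) (y : M₂) : Glued h :=
  Quotient.mk (gluingSetoid h) (Sum.inr y)

end Glued

/-- The map `f` between Riemannian manifolds with boundary is smooth and pulls back the metric of
the target to the metric of the source. -/
def IsIsometricImmersion (n : ℕ) [NeZero n] {M : Type u} {N : Type v}
    [TopologicalSpace M] [ChartedSpace (EuclideanHalfSpace n) M]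
    [RiemannianBundle (fun x : M => TangentSpace (𝓡∂ n) x)]
    [TopologicalSpace N] [ChartedSpace (EuclideanHalfSpace n) N]
    [RiemannianBundle (fun x : N => TangentSpace (𝓡∂ n) x)] (f : M → N) : Prop :=
  ContMDiff (𝓡∂ n) (𝓡∂ n) ∞ f ∧
    ∀ (x : M) (a b : TangentSpace (𝓡∂ n) x),
      inner ℝ (mfderiv (𝓡∂ n) (𝓡∂ n) f x a) (mfderiv (𝓡∂ n) (𝓡∂ n) f x b) = inner ℝ a b

section GluedHLS

variable {n : ℕ} [NeZero n] {q : ℕ} {r : WithTop ℕ∞}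
  {M₁ : Type u} [TopologicalSpace M₁] [ChartedSpace (EuclideanHalfSpace n) M₁]
  [RiemannianBundle (fun x : M₁ => TangentSpace (𝓡∂ n) x)]
  {M₂ : Type v} [TopologicalSpace M₂] [ChartedSpace (EuclideanHalfSpace n) M₂]
  [RiemannianBundle (fun x : M₂ => TangentSpace (𝓡∂ n) x)]
  {S₁ : Set M₁} {S₂ : Set M₂}

/-- The equivalence relation on `HLS F₁ ⊔ HLS F₂` generated by `π₁ x ∼ π₂ (h x)` for `x ∈ S₁`. -/
def hlsGluingSetoid (F₁ : Foliation n q r M₁) (F₂ : Foliation n q r M₂) (h : S₁ ≃ₜ S₂) :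
    Setoid (F₁.HLS ⊕ F₂.HLS) :=
  Relation.EqvGen.setoid fun a b =>
    ∃ x : S₁, a = Sum.inl (F₁.toHLS x) ∧ b = Sum.inr (F₂.toHLS (h x))

/-- The quotient metric space of `HLS F₁ ⊔ HLS F₂` by the relation `hlsGluingSetoid`. -/
def GluedHLS (F₁ : Foliation n q r M₁) (F₂ : Foliation n q r M₂) (h : S₁ ≃ₜ S₂) :
    Type (max u v) :=
  MetricQuotient (sumEDist F₁.HLS F₂.HLS) (sumEDist_comm F₁.HLS F₂.HLS) (hlsGluingSetoid F₁ F₂ h)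

instance instEMetricSpaceGluedHLS (F₁ : Foliation n q r M₁) (F₂ : Foliation n q r M₂)
    (h : S₁ ≃ₜ S₂) : EMetricSpace (GluedHLS F₁ F₂ h) :=
  inferInstanceAs (EMetricSpace (MetricQuotient _ _ _))

end GluedHLS

end

/-! The two spaces are related by mutually inverse nonexpanding maps, which are therefore
isometries. A quotient metric is universal: a nonexpanding map that is constant on classes factors
through a nonexpanding map of the quotient (`MetricQuotient.exists_lift`), so each map only has to
be controlled on points.

From the glued leaf space to `F.HLS` this is easy: an inclusion of a piece into `M` preserves
lengths of curves, hence does not increase distances (`riemannianEDist_map_le`).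

The other direction is the substance. A curve in `M` may cross the gluing hypersurface infinitely
often, so it cannot be cut into finitely many arcs lying in the pieces. The argument is
infinitesimal instead (`edist_le_riemannianEDist_of_cover`). At each time `t` one of the two closed
pieces contains `γ z` for a sequence `z ↓ t`, hence also `γ t`. In that piece the Riemannian
distance from `γ t` to `γ z` is at most `r * (z - t)` for any `r` above the speed of `γ` at `t`
(`eventually_riemannianEDist_le_of_map_eq`). This bounds a lower right derivative, and a mean value
inequality for such derivatives (`edist_le_ofReal_integral_of_frequently`) bounds the distance of
the endpoints by the length of `γ`. -/

section Preliminaries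

open Set Filter MeasureTheory

/-! ### Universal property of quotient metrics. -/

section MetricQuotientLift

variable {α : Type*} {Y : Type*}

theorem eq_of_eqvGen {r : α → α → Prop} {f : α → Y} (hr : ∀ a b, r a b → f a = f b) {a b : α}
    (hab : Relation.EqvGen.setoid r a b) : f a = f b := by
  induction hab with
  | rel a b hab => exact hr a b hab
  | refl a => rfl
  | symm a b _ ih => exact ih.symm
  | trans a b c _ _ ih ih' => exact ih.trans ih'

theorem chainEDist_mk_le (d : α → α → ℝ≥0∞) (s : Setoid α) (x y : α) :
    chainEDist d s (Quotient.mk s x) (Quotient.mk s y) ≤ d x y := by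
  refine (chainEDist_le 1 (fun i => if i = 0 then Quotient.mk s x else Quotient.mk s y)
    (by simp) (by simp)).trans ?_
  simp only [Finset.range_one, Finset.sum_singleton]
  exact iInf_le_of_le x (iInf_le_of_le y (iInf_le_of_le rfl (iInf_le_of_le rfl le_rfl)))

/-- The triangle inequality in `Y` along the image of a chain. -/
theorem edist_le_chainEDist [PseudoEMetricSpace Y] {d : α → α → ℝ≥0∞} {s : Setoid α}
    {f : Quotient s → Y}
    (hf : ∀ x y, edist (f (Quotient.mk s x)) (f (Quotient.mk s y)) ≤ d x y) (A B : Quotient s) :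
    edist (f A) (f B) ≤ chainEDist d s A B := by
  have hclass : ∀ A B, edist (f A) (f B) ≤ classEDist d s A B := by
    intro A B
    refine le_iInf fun p => le_iInf fun q => le_iInf fun hp => le_iInf fun hq => ?_
    subst hp hq
    exact hf p q
  refine le_iInf fun k => le_iInf fun L => le_iInf fun h0 => le_iInf fun hk => ?_
  subst h0 hk
  exact (edist_le_range_sum_edist (fun i => f (L i)) k).trans
    (Finset.sum_le_sum fun i _ => hclass _ _)

theorem MetricQuotient.proj_surjective (d : α → α → ℝ≥0∞) (hd : ∀ x y, d x y = d y x)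
    (s : Setoid α) : Function.Surjective (MetricQuotient.proj d hd s) := by
  intro z
  obtain ⟨w, rfl⟩ := SeparationQuotient.surjective_mk z
  obtain ⟨x, rfl⟩ := Quotient.exists_rep w
  exact ⟨x, rfl⟩

theorem MetricQuotient.edist_proj_le (d : α → α → ℝ≥0∞) (hd : ∀ x y, d x y = d y x)
    (s : Setoid α) (x y : α) :
    edist (MetricQuotient.proj d hd s x) (MetricQuotient.proj d hd s y) ≤ d x y :=
  chainEDist_mk_le d s x y

theorem MetricQuotient.proj_eq_of_rel {d : α → α → ℝ≥0∞} {hd : ∀ x y, d x y = d y x}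
    {s : Setoid α} {x y : α} (h : s x y) :
    MetricQuotient.proj d hd s x = MetricQuotient.proj d hd s y :=
  congrArg (SeparationQuotient.mk (X := PreMetricQuotient d hd s)) (Quotient.sound h)

/-- A nonexpanding map that is constant on the classes of `s` factors through a nonexpanding map
of the quotient metric space. -/
theorem MetricQuotient.exists_lift [EMetricSpace Y] (d : α → α → ℝ≥0∞)
    (hd : ∀ x y, d x y = d y x) (s : Setoid α) (f : α → Y) (hs : ∀ x y, s x y → f x = f y)
    (hf : ∀ x y, edist (f x) (f y) ≤ d x y) :
    ∃ g : MetricQuotient d hd s → Y, (∀ x, g (MetricQuotient.proj d hd s x) = f x) ∧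
      ∀ z w, edist (g z) (g w) ≤ edist z w := by
  have hle : ∀ z w : PreMetricQuotient d hd s,
      edist (Quotient.lift f hs z) (Quotient.lift f hs w) ≤ edist z w :=
    fun z w => edist_le_chainEDist (f := Quotient.lift f hs) hf z w
  refine ⟨SeparationQuotient.lift (X := PreMetricQuotient d hd s) (Quotient.lift f hs)
    fun z w hzw => ?_, fun x => rfl, fun z w => ?_⟩
  -- Classes at distance zero have images at distance zero, which coincide because `Y` is separated.
  · have h0 := hle z w
    rw [EMetric.inseparable_iff.1 hzw] at h0
    exact edist_eq_zero.1 (le_antisymm h0 zero_le)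
  · obtain ⟨z, rfl⟩ := SeparationQuotient.surjective_mk z
    obtain ⟨w, rfl⟩ := SeparationQuotient.surjective_mk w
    exact hle z w

theorem nonempty_isometryEquiv_of_nonexpanding {X Y : Type*} [PseudoEMetricSpace X]
    [PseudoEMetricSpace Y] {f : X → Y} {g : Y → X} (hgf : ∀ x, g (f x) = x)
    (hfg : ∀ y, f (g y) = y) (hf : ∀ x x', edist (f x) (f x') ≤ edist x x')
    (hg : ∀ y y', edist (g y) (g y') ≤ edist y y') : Nonempty (X ≃ᵢ Y) :=
  ⟨{ toFun := f, invFun := g, left_inv := hgf, right_inv := hfg,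
     isometry_toFun := fun x x' => le_antisymm (hf x x') (by simpa [hgf] using hg (f x) (f x')) }⟩

end MetricQuotientLift

/-! ### A mean value inequality for curves in an extended metric space. -/

/-- If, just after each time, the metric speed of a curve is at most `v` along some sequence of
times, then the distance between its endpoints is at most `∫ v`. -/
theorem edist_le_ofReal_integral_of_frequently {X : Type*} [PseudoEMetricSpace X] {c : ℝ → X}
    {a b : ℝ} (hab : a ≤ b) (hc : ContinuousOn c (Icc a b)) {v : ℝ → ℝ} (hv : Continuous v)
    (hv0 : ∀ t, 0 ≤ v t)
    (hspeed : ∀ t ∈ Ico a b, ∀ r, v t < r →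
      ∃ᶠ z in 𝓝[>] t, edist (c t) (c z) ≤ ENNReal.ofReal (r * (z - t))) :
    edist (c a) (c b) ≤ ENNReal.ofReal (∫ t in a..b, v t) := by
  -- Distances may be infinite, so the real-valued comparison is made for the distance truncated at
  -- `K`. As `K` exceeds the integral, a bound on the truncated distance by the integral bounds the
  -- distance itself.
  set K : ℝ≥0∞ := ENNReal.ofReal (∫ t in a..b, v t) + 1 with hK
  have hKtop : K ≠ ⊤ := by simp [hK]
  have hmin : ∀ t, min (edist (c a) (c t)) K ≠ ⊤ := fun t => (min_le_right _ _).trans_lt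
    hKtop.lt_top |>.ne
  have hfc : ContinuousOn (fun t => (min (edist (c a) (c t)) K).toReal) (Icc a b) := by
    refine ENNReal.continuousOn_toReal.comp ?_ fun t _ => hmin t
    exact ((continuous_const.edist continuous_id).min continuous_const).comp_continuousOn hc
  have hB : ∀ t, HasDerivAt (fun x => ∫ s in a..x, v s) (v t) t := fun t =>
    intervalIntegral.integral_hasDerivAt_right (hv.intervalIntegrable _ _)
      hv.aestronglyMeasurable.stronglyMeasurableAtFilter hv.continuousAt
  have key := image_le_of_liminf_slope_right_le_deriv_boundary hfc
    (B := fun x => ∫ s in a..x, v s) (B' := v) (by simp)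
    (fun t _ => (hB t).continuousAt.continuousWithinAt) (fun t _ => (hB t).hasDerivWithinAt)
    (fun t ht r hr => ?_) (right_mem_Icc.2 hab)
  · have h1 : min (edist (c a) (c b)) K ≤ ENNReal.ofReal (∫ t in a..b, v t) := by
      rw [← ENNReal.ofReal_toReal (hmin b)]
      exact ENNReal.ofReal_le_ofReal key
    rcases min_le_iff.1 h1 with h | h
    · exact h
    · exact absurd h (not_le.2 (ENNReal.lt_add_right ENNReal.ofReal_ne_top one_ne_zero))
  -- The slope must be strictly below `r`, whence the intermediate `r'`.
  · obtain ⟨r', hr', hr'r⟩ := exists_between hr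
    refine ((hspeed t ht r' hr').and_eventually self_mem_nhdsWithin).mono fun z hz => ?_
    obtain ⟨hz, htz : t < z⟩ := hz
    have hpos : 0 < z - t := sub_pos.2 htz
    rw [slope_def_field, div_lt_iff₀ hpos, sub_lt_iff_lt_add']
    have hle : min (edist (c a) (c z)) K ≤
        min (edist (c a) (c t)) K + ENNReal.ofReal (r' * (z - t)) := by
      rw [← min_add_add_right]
      exact min_le_min ((edist_triangle _ _ _).trans (add_le_add_right hz _)) le_self_add
    have h0 : 0 ≤ r' := (hv0 t).trans hr'.le
    have := ENNReal.toReal_mono (ENNReal.add_ne_top.2 ⟨hmin t, ENNReal.ofReal_ne_top⟩) hle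
    rw [ENNReal.toReal_add (hmin t) ENNReal.ofReal_ne_top,
      ENNReal.toReal_ofReal (by positivity)] at this
    nlinarith

/-! ### Topology of the glued space. -/

section Gluing

variable {M₁ : Type*} {M₂ : Type*} [TopologicalSpace M₁] [TopologicalSpace M₂]
  {S₁ : Set M₁} {S₂ : Set M₂}

/-- The boundary is closed and locally connected: in a chart at a limit point `x` of `S` it is a
convex piece of a hyperplane, so `x` lies in the boundary component of a nearby point of `S`. -/
theorem IsUnionOfBoundaryComponents.isClosed {n : ℕ} [NeZero n] {M : Type*} [TopologicalSpace M]
    [ChartedSpace (EuclideanHalfSpace n) M] [IsManifold (𝓡∂ n) 1 M] {S : Set M}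
    (hS : IsUnionOfBoundaryComponents n S) : IsClosed S := by
  refine isClosed_of_closure_subset fun x hx => ?_
  have hbd : IsClosed ((𝓡∂ n).boundary M) := (𝓡∂ n).isClosed_boundary one_ne_zero
  have hxb : x ∈ (𝓡∂ n).boundary M := closure_minimal hS.1 hbd hx
  obtain ⟨ρ, hρ, hsub⟩ := Metric.mem_nhdsWithin_iff.1
    (extChartAt_target_mem_nhdsWithin (I := 𝓡∂ n) x)
  set e := extChartAt (𝓡∂ n) x with he
  -- Whether a point is interior can be tested in any chart of the atlas, so the single chart at `x`
  -- describes the boundary throughout its domain.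
  have hiff : ∀ y ∈ e.source, (y ∈ (𝓡∂ n).boundary M ↔ e y ∈ frontier (range (𝓡∂ n))) := by
    intro y hy
    have hy' : y ∈ (chartAt (EuclideanHalfSpace n) x).source := by simpa [he] using hy
    have h1 := (𝓡∂ n).isInteriorPoint_iff_of_mem_atlas one_ne_zero
      (chart_mem_atlas (EuclideanHalfSpace n) x) hy'
    have h2 : e y ∈ interior (range (𝓡∂ n)) ↔ e y ∈ interior e.target :=
      ⟨fun h => (chartAt (EuclideanHalfSpace n) x).mem_interior_extend_target
        ((chartAt (EuclideanHalfSpace n) x).map_source hy') h,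
        fun h => interior_mono (extChartAt_target_subset_range x) h⟩
    have h3 : y ∈ (𝓡∂ n).boundary M ↔ ¬ (𝓡∂ n).IsInteriorPoint y := by
      rw [← (𝓡∂ n).isBoundaryPoint_iff_not_isInteriorPoint]; rfl
    have h4 : e y ∈ range (𝓡∂ n) := extChartAt_target_subset_range x (e.map_source hy)
    rw [h3, h1, (𝓡∂ n).isClosed_range.frontier_eq, Set.mem_sdiff, h2]
    exact ⟨fun h => ⟨h4, h⟩, fun h => h.2⟩
  set W : Set (EuclideanSpace ℝ (Fin n)) := Metric.ball (e x) ρ ∩ frontier (range (𝓡∂ n)) with hW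
  have hfr : frontier (range (𝓡∂ n)) ⊆ range (𝓡∂ n) := (𝓡∂ n).isClosed_range.frontier_subset
  have hWt : W ⊆ e.target := fun y hy => hsub ⟨hy.1, hfr hy.2⟩
  have hWc : IsPreconnected W := by
    refine Convex.isPreconnected ((convex_ball _ _).inter ?_)
    rw [frontier_range_modelWithCornersEuclideanHalfSpace]
    intro y hy z hz a b _ _ hab
    have hy0 : 0 = y 0 := hy
    have hz0 : 0 = z 0 := hz
    simp [← hy0, ← hz0]
  have hV : e ⁻¹' Metric.ball (e x) ρ ∩ e.source ∈ 𝓝 x :=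
    inter_mem ((continuousAt_extChartAt x).preimage_mem_nhds (Metric.ball_mem_nhds _ hρ))
      (extChartAt_source_mem_nhds x)
  obtain ⟨y, ⟨hyb, hys⟩, hyS⟩ := mem_closure_iff_nhds.1 hx _ hV
  have himg : IsPreconnected (e.symm '' W) :=
    hWc.image _ ((continuousOn_extChartAt_symm x).mono hWt)
  have hmem : ∀ z ∈ e.source, e z ∈ Metric.ball (e x) ρ → z ∈ (𝓡∂ n).boundary M →
      z ∈ e.symm '' W :=
    fun z hz hzb hzbd => ⟨e z, ⟨hzb, (hiff z hz).1 hzbd⟩, e.left_inv hz⟩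
  have himgb : e.symm '' W ⊆ (𝓡∂ n).boundary M := by
    rintro _ ⟨w, hw, rfl⟩
    rw [hiff _ (e.map_target (hWt hw)), e.right_inv (hWt hw)]
    exact hw.2
  exact hS.2 y hyS (himg.subset_connectedComponentIn (hmem y hys hyb (hS.1 hyS)) himgb
    (hmem x (mem_extChartAt_source x) (Metric.mem_ball_self hρ) hxb))

/-- Since `h` is injective, consecutive identifications cancel and chains collapse to length at most
one. -/
theorem gluingSetoid_cases {h : S₁ ≃ₜ S₂} {a b : M₁ ⊕ M₂} (hab : gluingSetoid h a b) :
    a = b ∨ (∃ x : S₁, a = Sum.inl (x : M₁) ∧ b = Sum.inr (h x : M₂)) ∨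
      ∃ x : S₁, b = Sum.inl (x : M₁) ∧ a = Sum.inr (h x : M₂) := by
  induction hab with
  | rel a b hab => exact Or.inr (Or.inl hab)
  | refl a => exact Or.inl rfl
  | symm a b _ ih =>
    rcases ih with ih | ih | ih
    · exact Or.inl ih.symm
    · exact Or.inr (Or.inr ih)
    · exact Or.inr (Or.inl ih)
  | trans a b c _ _ ih ih' =>
    rcases ih with rfl | ⟨x, rfl, rfl⟩ | ⟨x, rfl, rfl⟩
    · exact ih'
    · rcases ih' with rfl | ⟨y, h1, h2⟩ | ⟨y, rfl, h2⟩
      · exact Or.inr (Or.inl ⟨x, rfl, rfl⟩)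
      · simp at h1
      · left
        rw [h.injective (Subtype.ext (Sum.inr.inj h2))]
    · rcases ih' with rfl | ⟨y, h1, rfl⟩ | ⟨y, rfl, h2⟩
      · exact Or.inr (Or.inr ⟨x, rfl, rfl⟩)
      · left
        have : x = y := by simpa [Subtype.ext_iff] using h1
        rw [this]
      · simp at h2

theorem Glued.inl_injective (h : S₁ ≃ₜ S₂) : Function.Injective (Glued.inl h) := by
  intro x y hxy
  rcases gluingSetoid_cases (Quotient.exact hxy) with h1 | ⟨z, _, h1⟩ | ⟨z, _, h1⟩ <;>
    simp_all

theorem Glued.inr_injective (h : S₁ ≃ₜ S₂) : Function.Injective (Glued.inr h) := by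
  intro x y hxy
  rcases gluingSetoid_cases (Quotient.exact hxy) with h1 | ⟨z, h1, _⟩ | ⟨z, h1, _⟩ <;>
    simp_all

theorem Glued.inl_eq_inr_iff {h : S₁ ≃ₜ S₂} {x : M₁} {y : M₂} :
    Glued.inl h x = Glued.inr h y ↔ ∃ z : S₁, (z : M₁) = x ∧ (h z : M₂) = y := by
  constructor
  · intro hxy
    rcases gluingSetoid_cases (Quotient.exact hxy) with h1 | ⟨z, h1, h2⟩ | ⟨z, h1, h2⟩
    · simp at h1
    · exact ⟨z, by simpa using h1.symm, by simpa using h2.symm⟩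
    · simp at h1
  · rintro ⟨z, rfl, rfl⟩
    exact Quotient.sound (Relation.EqvGen.rel _ _ ⟨z, rfl, rfl⟩)

theorem Glued.exists_inl_or_inr (h : S₁ ≃ₜ S₂) (p : Glued h) :
    (∃ x, Glued.inl h x = p) ∨ ∃ y, Glued.inr h y = p := by
  obtain ⟨x | y, rfl⟩ := Quotient.exists_rep p
  exacts [Or.inl ⟨x, rfl⟩, Or.inr ⟨y, rfl⟩]

theorem Glued.continuous_inl (h : S₁ ≃ₜ S₂) : Continuous (Glued.inl h) :=
  continuous_quotient_mk'.comp _root_.continuous_inl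

theorem Glued.continuous_inr (h : S₁ ≃ₜ S₂) : Continuous (Glued.inr h) :=
  continuous_quotient_mk'.comp _root_.continuous_inr

theorem Glued.isClosed_iff {h : S₁ ≃ₜ S₂} {C : Set (Glued h)} :
    IsClosed C ↔ IsClosed (Glued.inl h ⁻¹' C) ∧ IsClosed (Glued.inr h ⁻¹' C) := by
  have h1 := (isQuotientMap_quotient_mk' (s := gluingSetoid h)).isClosed_preimage (s := C)
  rw [isClosed_sum_iff] at h1
  exact h1.symm

/-- The image of a closed `C` meets the other piece in `h (C ∩ S₁)`, which is closed in `S₂` and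
hence in `M₂`. -/
theorem Glued.isClosedEmbedding_inl (h : S₁ ≃ₜ S₂) (hS₂ : IsClosed S₂) :
    Topology.IsClosedEmbedding (Glued.inl h) := by
  refine .of_continuous_injective_isClosedMap (Glued.continuous_inl h) (Glued.inl_injective h)
    fun C hC => Glued.isClosed_iff.2 ⟨?_, ?_⟩
  · rwa [preimage_image_eq _ (Glued.inl_injective h)]
  · have : Glued.inr h ⁻¹' (Glued.inl h '' C) = Subtype.val '' (h '' (Subtype.val ⁻¹' C)) := by
      ext y
      simp only [mem_preimage, mem_image, Glued.inl_eq_inr_iff]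
      constructor
      · rintro ⟨x, hx, z, rfl, rfl⟩
        exact ⟨h z, ⟨z, hx, rfl⟩, rfl⟩
      · rintro ⟨_, ⟨z, hz, rfl⟩, rfl⟩
        exact ⟨z, hz, z, rfl, rfl⟩
    rw [this]
    exact hS₂.isClosedEmbedding_subtypeVal.isClosedMap _
      (h.isClosedMap _ (hC.preimage continuous_subtype_val))

theorem Glued.isClosedEmbedding_inr (h : S₁ ≃ₜ S₂) (hS₁ : IsClosed S₁) :
    Topology.IsClosedEmbedding (Glued.inr h) := by
  refine .of_continuous_injective_isClosedMap (Glued.continuous_inr h) (Glued.inr_injective h)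
    fun C hC => Glued.isClosed_iff.2 ⟨?_, ?_⟩
  · have : Glued.inl h ⁻¹' (Glued.inr h '' C) = Subtype.val '' (h ⁻¹' (Subtype.val ⁻¹' C)) := by
      ext x
      simp only [mem_preimage, mem_image, eq_comm (b := Glued.inl h x), Glued.inl_eq_inr_iff]
      constructor
      · rintro ⟨y, hy, z, rfl, rfl⟩
        exact ⟨z, hy, rfl⟩
      · rintro ⟨z, hz, rfl⟩
        exact ⟨h z, hz, z, rfl, rfl⟩
    rw [this]
    exact hS₁.isClosedEmbedding_subtypeVal.isClosedMap _
      ((hC.preimage continuous_subtype_val).preimage h.continuous)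
  · rwa [preimage_image_eq _ (Glued.inr_injective h)]

end Gluing

/-! ### Riemannian distance compared with the norm in a chart. -/

section LocalDistance

variable {E : Type*} [NormedAddCommGroup E] [NormedSpace ℝ E] {H : Type*} [TopologicalSpace H]
  {I : ModelWithCorners ℝ E H} {M : Type*} [TopologicalSpace M] [ChartedSpace H M]
  [RiemannianBundle (fun x : M => TangentSpace I x)]

/-- The norm of the tangent vector at `x` whose coordinate vector in the preferred chart at `x` is
`v`. -/
noncomputable def normInChartAt (I : ModelWithCorners ℝ E H) {M : Type*} [TopologicalSpace M] [ChartedSpace H M]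
    [RiemannianBundle (fun x : M => TangentSpace I x)] (x : M) (v : E) : ℝ :=
  ‖(show TangentSpace I x from v)‖

theorem continuous_normInChartAt (x : M) : Continuous (normInChartAt I x) :=
  continuous_norm (E := TangentSpace I x)

theorem normInChartAt_nonneg (x : M) (v : E) : 0 ≤ normInChartAt I x v :=
  norm_nonneg (E := TangentSpace I x) _

theorem normInChartAt_add_le (x : M) (v w : E) :
    normInChartAt I x (v + w) ≤ normInChartAt I x v + normInChartAt I x w :=
  norm_add_le (E := TangentSpace I x) _ _

theorem normInChartAt_smul (x : M) (a : ℝ) (v : E) :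
    normInChartAt I x (a • v) = |a| * normInChartAt I x v :=
  norm_smul (β := TangentSpace I x) a _

/-- The Riemannian norm on the tangent space induces the topology of `E`, so the identity is bounded
in both directions. Adding `1` to its norm keeps the constant positive. -/
theorem exists_normInChartAt_le (x : M) : ∃ C > 0, ∀ v, normInChartAt I x v ≤ C * ‖v‖ := by
  let L : E →L[ℝ] TangentSpace I x := ContinuousLinearMap.id ℝ E
  refine ⟨‖L‖ + 1, by positivity, fun v => (L.le_opNorm v).trans ?_⟩
  gcongr
  linarith

theorem exists_le_normInChartAt (x : M) : ∃ C > 0, ∀ v, ‖v‖ ≤ C * normInChartAt I x v := by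
  let L : TangentSpace I x →L[ℝ] E := ContinuousLinearMap.id ℝ E
  refine ⟨‖L‖ + 1, by positivity, fun v => (L.le_opNorm v).trans ?_⟩
  have := normInChartAt_nonneg (I := I) x v
  change ‖L‖ * normInChartAt I x v ≤ _
  gcongr
  linarith

variable [IsManifold I 1 M] [IsContinuousRiemannianBundle E (fun x : M => TangentSpace I x)]

/-- The trivialization at `x` is the identity on the fibre over `x`, and the metric is continuous,
so nearby norms are at most `r` times the norm at `x`. -/
theorem eventually_norm_mfderivWithin_extChartAt_symm_le (x : M) {r : ℝ} (hr : 1 < r) :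
    ∀ᶠ y in 𝓝[range I] (extChartAt I x x), ∀ v : E,
      ‖mfderivWithin 𝓘(ℝ, E) I (extChartAt I x).symm (range I) y v‖ ≤ r * normInChartAt I x v := by
  have hid : ∀ v : TangentSpace I x,
      (trivializationAt E (TangentSpace I) x).continuousLinearMapAt ℝ x v = (show E from v) := by
    intro v
    rw [TangentBundle.continuousLinearMapAt_trivializationAt_eq_core (mem_chart_source H x)]
    exact (tangentBundleCore I M).coordChange_self (achart H x) x (mem_chart_source H x) v
  have h1 := eventually_norm_symmL_trivializationAt_comp_self_lt E
    (fun x : M => TangentSpace I x) x hr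
  have h2 : ∀ᶠ y in 𝓝 x, ∀ v : E,
      ‖mfderivWithin 𝓘(ℝ, E) I (extChartAt I x).symm (range I) (extChartAt I x y) v‖ ≤
        r * normInChartAt I x v := by
    filter_upwards [h1, chart_source_mem_nhds H x] with y hy h'y v
    have h3 : ‖(trivializationAt E (TangentSpace I) x).symmL ℝ y
        ((trivializationAt E (TangentSpace I) x).continuousLinearMapAt ℝ x v)‖ ≤
          r * normInChartAt I x v :=
      ((((trivializationAt E (TangentSpace I) x).symmL ℝ y) ∘L
        ((trivializationAt E (TangentSpace I) x).continuousLinearMapAt ℝ x)).le_opNorm v).trans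
        (mul_le_mul_of_nonneg_right hy.le (norm_nonneg _))
    erw [hid v, TangentBundle.symmL_trivializationAt h'y] at h3
    have A : (extChartAt I x).symm (extChartAt I x y) = y :=
      (extChartAt I x).left_inv (by simpa using h'y)
    convert! h3 using 2
    congr
  have h3 : Tendsto (extChartAt I x).symm (𝓝[range I] (extChartAt I x x)) (𝓝 x) := by
    have := (continuousAt_extChartAt_symm (I := I) x).tendsto
    rw [extChartAt_to_inv] at this
    exact this.mono_left nhdsWithin_le_nhds
  filter_upwards [h3.eventually h2, extChartAt_target_mem_nhdsWithin x] with y hy h'y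
  rwa [(extChartAt I x).right_inv h'y] at hy

/-- The segment between the coordinates stays in the convex set `range I`; its preimage in the
manifold is a curve of at most the stated length. -/
theorem eventually_riemannianEDist_le_normInChartAt (x : M) {r : ℝ} (hr : 1 < r) :
    ∀ᶠ y in 𝓝 x, riemannianEDist I x y ≤
      ENNReal.ofReal (r * normInChartAt I x (extChartAt I x y - extChartAt I x x)) := by
  obtain ⟨ρ, hρ, hsub⟩ := Metric.mem_nhdsWithin_iff.1
    (inter_mem (extChartAt_target_mem_nhdsWithin x)
      (eventually_norm_mfderivWithin_extChartAt_symm_le (I := I) x hr))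
  have A : (extChartAt I x) ⁻¹' (Metric.ball (extChartAt I x x) ρ ∩ range I) ∈ 𝓝 x := by
    apply extChartAt_preimage_mem_nhds_of_mem_nhdsWithin (by simp)
    rw [inter_comm]
    exact inter_mem_nhdsWithin _ (Metric.ball_mem_nhds _ hρ)
  filter_upwards [A, chart_source_mem_nhds H x] with y hy h'y
  let η := ContinuousAffineMap.lineMap (R := ℝ) (extChartAt I x x) (extChartAt I x y)
  set γ := (extChartAt I x).symm ∘ η with hγ
  have hη : Icc 0 1 ⊆ ⇑η ⁻¹' (Metric.ball (extChartAt I x x) ρ ∩ range I) := by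
    simp only [← image_subset_iff, ContinuousAffineMap.coe_lineMap_eq,
      ← segment_eq_image_lineMap, η]
    exact ((convex_ball _ _).inter I.convex_range).segment_subset (by simp [hρ]) hy
  have hηt : Icc 0 1 ⊆ ⇑η ⁻¹' (extChartAt I x).target := fun t ht => (hsub (hη ht)).1
  have η_smooth : ContMDiffOn 𝓘(ℝ, ℝ) 𝓘(ℝ, E) 1 η (Icc 0 1) := by
    apply ContMDiff.contMDiffOn
    rw [contMDiff_iff_contDiff]
    exact ContinuousAffineMap.contDiff _
  have hle : riemannianEDist I x y ≤ pathELength I γ 0 1 := by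
    apply riemannianEDist_le_pathELength _ _ _ zero_le_one
    · exact (contMDiffOn_extChartAt_symm x).comp η_smooth hηt
    · simp [γ, η, ContinuousAffineMap.coe_lineMap_eq]
    · simp [γ, η, ContinuousAffineMap.coe_lineMap_eq, h'y]
  refine hle.trans ?_
  rw [pathELength_eq_lintegral_mfderivWithin_Icc]
  have hbound : ∀ t ∈ Icc (0 : ℝ) 1, ‖mfderivWithin 𝓘(ℝ, ℝ) I γ (Icc 0 1) t 1‖ₑ ≤
      ENNReal.ofReal (r * normInChartAt I x (extChartAt I x y - extChartAt I x x)) := by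
    intro t ht
    have h1 : mfderivWithin 𝓘(ℝ, ℝ) I γ (Icc 0 1) t =
        (mfderivWithin 𝓘(ℝ, E) I (extChartAt I x).symm (range I) (η t)) ∘L
          (mfderivWithin 𝓘(ℝ, ℝ) 𝓘(ℝ, E) η (Icc 0 1) t) := by
      apply mfderivWithin_comp
      · exact mdifferentiableWithinAt_extChartAt_symm (hηt ht)
      · exact η_smooth.mdifferentiableOn one_ne_zero t ht
      · exact hηt.trans (preimage_mono (extChartAt_target_subset_range x))
      · rw [uniqueMDiffWithinAt_iff_uniqueDiffWithinAt]
        exact uniqueDiffOn_Icc zero_lt_one t ht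
    have h2 : mfderivWithin 𝓘(ℝ, ℝ) 𝓘(ℝ, E) η (Icc 0 1) t (1 : ℝ) =
        extChartAt I x y - extChartAt I x x := by
      rw [mfderivWithin_eq_fderivWithin,
        fderivWithin_eq_fderiv (uniqueDiffOn_Icc zero_lt_one _ ht)
          (ContinuousAffineMap.differentiableAt _)]
      exact (AffineMap.hasDerivAt_lineMap (a := extChartAt I x x)
        (b := extChartAt I x y) (x := t)).deriv
    have h3 : mfderivWithin 𝓘(ℝ, ℝ) I γ (Icc 0 1) t (1 : ℝ) =
        mfderivWithin 𝓘(ℝ, E) I (extChartAt I x).symm (range I) (η t)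
          (extChartAt I x y - extChartAt I x x) := by
      rw [← h2, h1]; rfl
    have h4 := (hsub (hη ht)).2 (extChartAt I x y - extChartAt I x x)
    rw [← ofReal_norm]
    refine ENNReal.ofReal_le_ofReal ?_
    erw [h3]
    exact h4
  exact (setLIntegral_mono' measurableSet_Icc hbound).trans (by simp)

end LocalDistance

/-! ### Speed of differentiable curves. -/

section Curves

variable {E : Type*} [NormedAddCommGroup E] [NormedSpace ℝ E] {H : Type*} [TopologicalSpace H]
  {I : ModelWithCorners ℝ E H} {M : Type*} [TopologicalSpace M] [ChartedSpace H M]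
  [RiemannianBundle (fun x : M => TangentSpace I x)]

/-- Difference quotients in the chart tend to the velocity, and `r` is strictly above its norm. -/
theorem eventually_normInChartAt_sub_le {γ : ℝ → M} {t : ℝ}
    (hγ : MDifferentiableAt 𝓘(ℝ, ℝ) I γ t) {r : ℝ} (hr : ‖mfderiv 𝓘(ℝ, ℝ) I γ t 1‖ < r) :
    ∀ᶠ z in 𝓝[>] t, normInChartAt I (γ t)
      (extChartAt I (γ t) (γ z) - extChartAt I (γ t) (γ t)) ≤ r * (z - t) := by
  have hd : HasFDerivAt (extChartAt I (γ t) ∘ γ) (mfderiv 𝓘(ℝ, ℝ) I γ t : ℝ →L[ℝ] E) t := by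
    have := hγ.hasMFDerivAt.2
    rw [modelWithCornersSelf_coe, range_id] at this
    exact hasFDerivWithinAt_univ.1 this
  have hslope := (hasDerivAt_iff_tendsto_slope.1
    (HasFDerivAt.hasDerivAt (𝕜 := ℝ) (F := E) hd)).mono_left (nhdsWithin_mono t fun z hz => ne_of_gt hz)
  have hlim := ((continuous_normInChartAt (I := I) (γ t)).tendsto _).comp hslope
  filter_upwards [hlim.eventually_lt_const hr, self_mem_nhdsWithin] with z hz htz
  have hpos : 0 < z - t := sub_pos.2 htz
  rw [Function.comp_apply, slope_def_module, normInChartAt_smul, abs_of_pos (inv_pos.2 hpos),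
    inv_mul_lt_iff₀ hpos] at hz
  rw [mul_comm]
  exact hz.le

theorem continuous_norm_mfderiv [IsManifold I 1 M]
    [IsContinuousRiemannianBundle E (fun x : M => TangentSpace I x)] {γ : ℝ → M}
    (hγ : ContMDiff 𝓘(ℝ, ℝ) I 1 γ) : Continuous fun t => ‖mfderiv 𝓘(ℝ, ℝ) I γ t 1‖ := by
  have h1 : Continuous fun t => (⟨γ t, mfderiv 𝓘(ℝ, ℝ) I γ t 1⟩ : TangentBundle I M) := by
    have h2 := hγ.continuous_tangentMap le_rfl
    have h3 : Continuous fun t : ℝ => (⟨t, 1⟩ : TangentBundle 𝓘(ℝ, ℝ) ℝ) := by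
      have := (tangentBundleModelSpaceHomeomorph 𝓘(ℝ, ℝ)).symm.continuous.comp
        (continuous_id.prodMk (continuous_const (y := (1 : ℝ))))
      exact this
    exact h2.comp h3
  have h4 := h1.inner_bundle h1
  simp only [real_inner_self_eq_norm_sq] at h4
  simpa using h4.sqrt

end Curves

/-! ### Distances under isometric immersions. -/

section IsometricImmersions

variable {E : Type*} [NormedAddCommGroup E] [NormedSpace ℝ E] {H : Type*} [TopologicalSpace H]
  {I : ModelWithCorners ℝ E H}
  {N : Type*} [TopologicalSpace N] [ChartedSpace H N]
  [RiemannianBundle (fun x : N => TangentSpace I x)]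
  {M : Type*} [TopologicalSpace M] [ChartedSpace H M]
  [RiemannianBundle (fun x : M => TangentSpace I x)]

theorem riemannianEDist_map_le {f : N → M} (hf : ContMDiff I I 1 f)
    (hiso : ∀ (x : N) (v : TangentSpace I x), ‖mfderiv I I f x v‖ = ‖v‖) (x y : N) :
    riemannianEDist I (f x) (f y) ≤ riemannianEDist I x y := by
  refine le_of_forall_gt fun r hr => ?_
  obtain ⟨γ, rfl, rfl, hγ, hlt⟩ := exists_lt_of_riemannianEDist_lt hr
  refine (riemannianEDist_le_pathELength (γ := f ∘ γ) (hf.comp_contMDiffOn hγ) rfl rfl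
    zero_le_one).trans_lt (lt_of_eq_of_lt ?_ hlt)
  rw [pathELength_eq_lintegral_mfderivWithin_Icc, pathELength_eq_lintegral_mfderivWithin_Icc]
  refine setLIntegral_congr_fun measurableSet_Icc fun t ht => ?_
  have h1 := mfderiv_comp_mfderivWithin t (hf.mdifferentiable one_ne_zero (γ t))
    (hγ.mdifferentiableOn one_ne_zero t ht)
    (uniqueMDiffWithinAt_iff_uniqueDiffWithinAt.2 (uniqueDiffOn_Icc zero_lt_one t ht))
  have h2 : mfderivWithin 𝓘(ℝ, ℝ) I (f ∘ γ) (Icc 0 1) t (1 : ℝ) =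
      mfderiv I I f (γ t) (mfderivWithin 𝓘(ℝ, ℝ) I γ (Icc 0 1) t (1 : ℝ)) := by
    rw [h1]; rfl
  rw [← ofReal_norm, ← ofReal_norm]
  erw [h2, hiso]
  rfl

variable [IsManifold I 1 N] [IsContinuousRiemannianBundle E (fun x : N => TangentSpace I x)]

/-- With `u` the coordinate increment at `x`, the increment of `f` is `A u + o(u)`, where `A`
preserves norms. So the ambient increment controls `u`, which controls the distance in `N`. -/
theorem eventually_riemannianEDist_le_normInChartAt_map {f : N → M} {x : N}
    (hf : MDifferentiableAt I I f x)
    (hiso : ∀ v : TangentSpace I x, ‖mfderiv I I f x v‖ = ‖v‖) {r : ℝ} (hr : 1 < r) :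
    ∀ᶠ y in 𝓝 x, riemannianEDist I x y ≤ ENNReal.ofReal
      (r * normInChartAt I (f x) (extChartAt I (f x) (f y) - extChartAt I (f x) (f x))) := by
  obtain ⟨s, hs, hsr⟩ := exists_between hr
  obtain ⟨C, hC, hC'⟩ := exists_normInChartAt_le (I := I) (f x)
  obtain ⟨D, hD, hD'⟩ := exists_le_normInChartAt (I := I) x
  set A : E →L[ℝ] E := mfderiv I I f x with hA
  have hd : HasFDerivWithinAt (writtenInExtChartAt I I x f) A (range I) (extChartAt I x x) :=
    hf.hasMFDerivAt.2
  have hr0 : 0 < r := by linarith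
  have hδ : 0 < 1 - s / r := sub_pos.2 ((div_lt_one hr0).2 hsr)
  -- This tolerance makes the error at most `(1 - s / r)` times the norm of `u`, once `C` and `D`
  -- have converted between Riemannian and model norms.
  have ho := (hasFDerivWithinAt_iff_isLittleO.1 hd).def (div_pos hδ (mul_pos hC hD))
  have htend : Tendsto (extChartAt I x) (𝓝 x) (𝓝[range I] (extChartAt I x x)) :=
    tendsto_nhdsWithin_iff.2 ⟨continuousAt_extChartAt x, by
      filter_upwards [extChartAt_source_mem_nhds (I := I) x] with y hy
      exact extChartAt_target_subset_range x ((extChartAt I x).map_source hy)⟩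
  filter_upwards [htend.eventually ho, extChartAt_source_mem_nhds (I := I) x,
    eventually_riemannianEDist_le_normInChartAt (I := I) x hs] with y hy hys hdist
  refine hdist.trans (ENNReal.ofReal_le_ofReal ?_)
  simp only [writtenInExtChartAt, Function.comp_apply, (extChartAt I x).left_inv hys,
    extChartAt_to_inv] at hy
  set u := extChartAt I x y - extChartAt I x x
  set G := extChartAt I (f x) (f y) - extChartAt I (f x) (f x)
  have h1 : normInChartAt I (f x) (A u) = normInChartAt I x u := hiso u
  have h2 : normInChartAt I (f x) (A u) ≤
      normInChartAt I (f x) G + normInChartAt I (f x) (A u - G) := by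
    simpa using normInChartAt_add_le (I := I) (f x) G (A u - G)
  have h3 : normInChartAt I (f x) (A u - G) ≤ (1 - s / r) * normInChartAt I x u := by
    refine (hC' _).trans ?_
    rw [norm_sub_rev]
    calc C * ‖G - A u‖ ≤ C * ((1 - s / r) / (C * D) * (D * normInChartAt I x u)) := by
          gcongr
          exact hy.trans (by gcongr; exact hD' u)
      _ = (1 - s / r) * normInChartAt I x u := by field_simp
  have h4 : s / r * normInChartAt I x u ≤ normInChartAt I (f x) G := by linarith
  rw [div_mul_eq_mul_div, div_le_iff₀ hr0] at h4
  linarith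

/-- As `f` induces the topology of `N`, a point of `N` lying over `γ z` is close to `x` once `z` is
close to `t`. The factor `r` is split as `(r / s) * s`: the first part pays for the chart
comparison, the second for the speed. -/
theorem eventually_riemannianEDist_le_of_map_eq {f : N → M} (hemb : Topology.IsInducing f) {x : N}
    (hf : MDifferentiableAt I I f x)
    (hiso : ∀ v : TangentSpace I x, ‖mfderiv I I f x v‖ = ‖v‖) {γ : ℝ → M} {t : ℝ}
    (hγ : MDifferentiableAt 𝓘(ℝ, ℝ) I γ t) (hx : f x = γ t) {r : ℝ}
    (hr : ‖mfderiv 𝓘(ℝ, ℝ) I γ t 1‖ < r) :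
    ∀ᶠ z in 𝓝[>] t, ∀ y, f y = γ z → riemannianEDist I x y ≤ ENNReal.ofReal (r * (z - t)) := by
  obtain ⟨s, hs, hsr⟩ := exists_between hr
  have hs0 : 0 < s := (norm_nonneg _).trans_lt hs
  have h1 := eventually_riemannianEDist_le_normInChartAt_map hf hiso ((one_lt_div hs0).2 hsr)
  rw [hemb.nhds_eq_comap, eventually_comap, hx] at h1
  have hlim : Tendsto γ (𝓝[>] t) (𝓝 (γ t)) :=
    hγ.continuousAt.tendsto.mono_left nhdsWithin_le_nhds
  have h2 := hlim.eventually h1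
  filter_upwards [h2, eventually_normInChartAt_sub_le hγ hs] with z hz hz' y hy
  refine (hz y hy).trans (ENNReal.ofReal_le_ofReal ?_)
  rw [hy]
  calc r / s * _ ≤ r / s * (s * (z - t)) := by
        have : 0 < r := hs0.trans hsr
        gcongr
    _ = r * (z - t) := by field_simp

theorem continuous_of_edist_le_riemannianEDist {X : Type*} [PseudoEMetricSpace X] {φ : N → X}
    (hφ : ∀ x y, edist (φ x) (φ y) ≤ riemannianEDist I x y) : Continuous φ := by
  refine continuous_iff_continuousAt.2 fun x => EMetric.tendsto_nhds.2 fun ε hε => ?_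
  filter_upwards [eventually_riemannianEDist_lt I x hε] with y hy
  rw [edist_comm]
  exact (hφ x y).trans_lt hy

end IsometricImmersions

/-! ### Nonexpanding maps on a manifold covered by two closed pieces. -/

/-- If a Riemannian manifold `M` is covered by two isometrically immersed, topologically closed
pieces of the same dimension, a map on `M` which is nonexpanding for the Riemannian distance of
each of the pieces is nonexpanding for the Riemannian distance of `M`. -/
theorem edist_le_riemannianEDist_of_cover
    {E : Type*} [NormedAddCommGroup E] [NormedSpace ℝ E] {H : Type*} [TopologicalSpace H]
    {I : ModelWithCorners ℝ E H}
    {N₁ : Type*} [TopologicalSpace N₁] [ChartedSpace H N₁] [IsManifold I 1 N₁]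
    [RiemannianBundle (fun x : N₁ => TangentSpace I x)]
    [IsContinuousRiemannianBundle E (fun x : N₁ => TangentSpace I x)]
    {N₂ : Type*} [TopologicalSpace N₂] [ChartedSpace H N₂] [IsManifold I 1 N₂]
    [RiemannianBundle (fun x : N₂ => TangentSpace I x)]
    [IsContinuousRiemannianBundle E (fun x : N₂ => TangentSpace I x)]
    {M : Type*} [TopologicalSpace M] [ChartedSpace H M] [IsManifold I 1 M]
    [RiemannianBundle (fun x : M => TangentSpace I x)]
    [IsContinuousRiemannianBundle E (fun x : M => TangentSpace I x)]
    {f₁ : N₁ → M} (hf₁ : ContMDiff I I 1 f₁) (hc₁ : Topology.IsClosedEmbedding f₁)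
    (hiso₁ : ∀ (x : N₁) (v : TangentSpace I x), ‖mfderiv I I f₁ x v‖ = ‖v‖)
    {f₂ : N₂ → M} (hf₂ : ContMDiff I I 1 f₂) (hc₂ : Topology.IsClosedEmbedding f₂)
    (hiso₂ : ∀ (x : N₂) (v : TangentSpace I x), ‖mfderiv I I f₂ x v‖ = ‖v‖)
    (hcover : ∀ p, p ∈ range f₁ ∨ p ∈ range f₂)
    {X : Type*} [PseudoEMetricSpace X] {φ : M → X}
    (hφ₁ : ∀ x y, edist (φ (f₁ x)) (φ (f₁ y)) ≤ riemannianEDist I x y)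
    (hφ₂ : ∀ x y, edist (φ (f₂ x)) (φ (f₂ y)) ≤ riemannianEDist I x y) (p q : M) :
    edist (φ p) (φ q) ≤ riemannianEDist I p q := by
  have hquot : Topology.IsQuotientMap (Sum.elim f₁ f₂) := by
    refine (hc₁.isClosedMap.sumElim hc₂.isClosedMap).isQuotientMap
      (hc₁.continuous.sumElim hc₂.continuous) fun p => ?_
    rcases hcover p with ⟨x, rfl⟩ | ⟨x, rfl⟩
    exacts [⟨Sum.inl x, rfl⟩, ⟨Sum.inr x, rfl⟩]
  have hφ : Continuous φ := by
    rw [hquot.continuous_iff, continuous_sum_dom]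
    exact ⟨continuous_of_edist_le_riemannianEDist (I := I) hφ₁,
      continuous_of_edist_le_riemannianEDist (I := I) hφ₂⟩
  refine le_of_forall_gt fun R hR => ?_
  -- This curve is `C^1` on all of `ℝ`, so its speed is continuous everywhere, with no endpoint
  -- cases.
  obtain ⟨γ, rfl, rfl, hγ, hlt, -⟩ := exists_lt_locally_constant_of_riemannianEDist_lt hR
    zero_lt_one
  have hcont := continuous_norm_mfderiv hγ
  have hmd : ∀ t, MDifferentiableAt 𝓘(ℝ, ℝ) I γ t := hγ.mdifferentiable one_ne_zero
  have hlen : pathELength I γ 0 1 =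
      ENNReal.ofReal (∫ t in (0 : ℝ)..1, ‖mfderiv 𝓘(ℝ, ℝ) I γ t 1‖) := by
    rw [pathELength_eq_lintegral_mfderiv_Icc, intervalIntegral.integral_of_le zero_le_one,
      ofReal_integral_eq_lintegral_ofReal, restrict_Ioc_eq_restrict_Icc]
    · simp only [ofReal_norm]
    · exact (hcont.integrableOn_Icc (a := 0) (b := 1)).mono_set Ioc_subset_Icc_self
    · exact Eventually.of_forall fun t => norm_nonneg _
  rw [hlen] at hlt
  refine (edist_le_ofReal_integral_of_frequently (c := φ ∘ γ) zero_le_one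
    (hφ.comp hγ.continuous).continuousOn hcont (fun t => norm_nonneg _)
    fun t _ r hr => ?_).trans_lt hlt
  -- Which piece recurs just after `t` may depend on `t`; a frequent bound is all that the mean
  -- value inequality needs.
  have hfreq : (∃ᶠ z in 𝓝[>] t, γ z ∈ range f₁) ∨ ∃ᶠ z in 𝓝[>] t, γ z ∈ range f₂ :=
    frequently_or_distrib.1 (Eventually.of_forall fun z => hcover (γ z)).frequently
  have hlim : Tendsto γ (𝓝[>] t) (𝓝 (γ t)) :=
    hγ.continuous.continuousAt.tendsto.mono_left nhdsWithin_le_nhds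
  rcases hfreq with hfreq | hfreq
  · obtain ⟨x, hx⟩ := hc₁.isClosed_range.mem_of_frequently_of_tendsto hfreq hlim
    refine (hfreq.and_eventually (eventually_riemannianEDist_le_of_map_eq hc₁.isInducing
      (hf₁.mdifferentiable one_ne_zero x) (hiso₁ x) (hmd t) hx hr)).mono ?_
    rintro z ⟨⟨y, hy⟩, hz⟩
    rw [Function.comp_apply, Function.comp_apply, ← hx, ← hy]
    exact (hφ₁ x y).trans (hz y hy)
  · obtain ⟨x, hx⟩ := hc₂.isClosed_range.mem_of_frequently_of_tendsto hfreq hlim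
    refine (hfreq.and_eventually (eventually_riemannianEDist_le_of_map_eq hc₂.isInducing
      (hf₂.mdifferentiable one_ne_zero x) (hiso₂ x) (hmd t) hx hr)).mono ?_
    rintro z ⟨⟨y, hy⟩, hz⟩
    rw [Function.comp_apply, Function.comp_apply, ← hx, ← hy]
    exact (hφ₂ x y).trans (hz y hy)

theorem IsIsometricImmersion.norm_mfderiv {n : ℕ} [NeZero n] {M N : Type*}
    [TopologicalSpace M] [ChartedSpace (EuclideanHalfSpace n) M]
    [RiemannianBundle (fun x : M => TangentSpace (𝓡∂ n) x)]
    [TopologicalSpace N] [ChartedSpace (EuclideanHalfSpace n) N]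
    [RiemannianBundle (fun x : N => TangentSpace (𝓡∂ n) x)] {f : M → N}
    (hf : IsIsometricImmersion n f) (x : M) (v : TangentSpace (𝓡∂ n) x) :
    ‖mfderiv (𝓡∂ n) (𝓡∂ n) f x v‖ = ‖v‖ := by
  rw [norm_eq_sqrt_real_inner (F := TangentSpace (𝓡∂ n) (f x)), hf.2, norm_eq_sqrt_real_inner]

theorem isContinuousRiemannianBundle_of_isContMDiff {E : Type*} [NormedAddCommGroup E]
    {EB : Type*} [NormedAddCommGroup EB] [NormedSpace ℝ EB] {HB : Type*} [TopologicalSpace HB]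
    (IB : ModelWithCorners ℝ EB HB) {B : Type*} [TopologicalSpace B] [ChartedSpace HB B]
    [NormedSpace ℝ E] (V : B → Type*) [TopologicalSpace (TotalSpace E V)]
    [∀ x, NormedAddCommGroup (V x)] [∀ x, InnerProductSpace ℝ (V x)] [FiberBundle E V]
    [VectorBundle ℝ E V] [hV : IsContMDiffRiemannianBundle IB ∞ E V] :
    IsContinuousRiemannianBundle E V := by
  obtain ⟨g, hg, hg'⟩ := hV.exists_contMDiff
  exact ⟨g, hg.continuous, hg'⟩

end Preliminaries

/-! ### The isometry of leaf spaces. -/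

theorem mainTheorem5 {n : ℕ} [NeZero n] {q : ℕ} {r s : WithTop ℕ∞}
    -- the compact foliated Riemannian manifolds `(M_i, F_i, g_i)`, with `F_i` tangent to `∂M_i`
    {M₁ : Type*} [TopologicalSpace M₁] [T2Space M₁] [CompactSpace M₁]
    [ChartedSpace (EuclideanHalfSpace n) M₁] [IsManifold (𝓡∂ n) ∞ M₁]
    [RiemannianBundle (fun x : M₁ => TangentSpace (𝓡∂ n) x)]
    [IsContMDiffRiemannianBundle (𝓡∂ n) ∞ (EuclideanSpace ℝ (Fin n))
      (fun x : M₁ => TangentSpace (𝓡∂ n) x)]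
    {M₂ : Type*} [TopologicalSpace M₂] [T2Space M₂] [CompactSpace M₂]
    [ChartedSpace (EuclideanHalfSpace n) M₂] [IsManifold (𝓡∂ n) ∞ M₂]
    [RiemannianBundle (fun x : M₂ => TangentSpace (𝓡∂ n) x)]
    [IsContMDiffRiemannianBundle (𝓡∂ n) ∞ (EuclideanSpace ℝ (Fin n))
      (fun x : M₂ => TangentSpace (𝓡∂ n) x)]
    (F₁ : Foliation n q r M₁) (hF₁ : F₁.IsTangentToBoundary)
    (F₂ : Foliation n q r M₂) (hF₂ : F₂.IsTangentToBoundary)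
    -- the isometry `h : S₁ → S₂`, mapping leaves onto leaves
    {S₁ : Set M₁} (hS₁ : IsUnionOfBoundaryComponents n S₁)
    {S₂ : Set M₂} (hS₂ : IsUnionOfBoundaryComponents n S₂)
    (h : S₁ ≃ₜ S₂)
    (h_isometry : ∀ x y : S₁, intrinsicEDist n S₂ (h x) (h y) = intrinsicEDist n S₁ x y)
    (h_leaves : ∀ x : S₁, (fun y : S₁ => (h y : M₂)) '' {y : S₁ | (y : M₁) ∈ F₁.leaf x} =
      F₂.leaf (h x))
    -- a smooth structure and a Riemannian metric on `M = M₁ ∪_h M₂` that restrict to those of `M_i`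
    [ChartedSpace (EuclideanHalfSpace n) (Glued h)] [IsManifold (𝓡∂ n) ∞ (Glued h)]
    [RiemannianBundle (fun x : Glued h => TangentSpace (𝓡∂ n) x)]
    [IsContMDiffRiemannianBundle (𝓡∂ n) ∞ (EuclideanSpace ℝ (Fin n))
      (fun x : Glued h => TangentSpace (𝓡∂ n) x)]
    (hg₁ : IsIsometricImmersion n (Glued.inl h))
    (hg₂ : IsIsometricImmersion n (Glued.inr h))
    -- the glued foliation of `M`, whose leaves are the images of the leaves of `F₁` and `F₂`
    (F : Foliation n q s (Glued h))
    (hF_inl : ∀ x : M₁, F.leaf (Glued.inl h x) = Glued.inl h '' F₁.leaf x)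
    (hF_inr : ∀ x : M₂, F.leaf (Glued.inr h x) = Glued.inr h '' F₂.leaf x) :
    Nonempty (F.HLS ≃ᵢ GluedHLS F₁ F₂ h) := by
  have := isContinuousRiemannianBundle_of_isContMDiff (E := EuclideanSpace ℝ (Fin n))
    (𝓡∂ n) (fun x : M₁ => TangentSpace (𝓡∂ n) x)
  have := isContinuousRiemannianBundle_of_isContMDiff (E := EuclideanSpace ℝ (Fin n))
    (𝓡∂ n) (fun x : M₂ => TangentSpace (𝓡∂ n) x)
  have := isContinuousRiemannianBundle_of_isContMDiff (E := EuclideanSpace ℝ (Fin n))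
    (𝓡∂ n) (fun x : Glued h => TangentSpace (𝓡∂ n) x)
  -- The indices cross: `M₁` embeds as a closed set because its trace `S₂` on `M₂` is closed.
  have e₁ := Glued.isClosedEmbedding_inl h hS₂.isClosed
  have e₂ := Glued.isClosedEmbedding_inr h hS₁.isClosed
  have c₁ : ContMDiff (𝓡∂ n) (𝓡∂ n) 1 (Glued.inl h) := hg₁.1.of_le (by norm_cast)
  have c₂ : ContMDiff (𝓡∂ n) (𝓡∂ n) 1 (Glued.inr h) := hg₂.1.of_le (by norm_cast)
  let pr : F₁.HLS ⊕ F₂.HLS → GluedHLS F₁ F₂ h := MetricQuotient.proj _ _ _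
  have hpr : ∀ a b, edist (pr a) (pr b) ≤ sumEDist F₁.HLS F₂.HLS a b :=
    MetricQuotient.edist_proj_le _ _ _
  have hF₁_le : ∀ x y, edist (F₁.toHLS x) (F₁.toHLS y) ≤ riemannianEDist (𝓡∂ n) x y :=
    MetricQuotient.edist_proj_le _ _ _
  have hF₂_le : ∀ x y, edist (F₂.toHLS x) (F₂.toHLS y) ≤ riemannianEDist (𝓡∂ n) x y :=
    MetricQuotient.edist_proj_le _ _ _
  have hF_le : ∀ x y, edist (F.toHLS x) (F.toHLS y) ≤ riemannianEDist (𝓡∂ n) x y :=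
    MetricQuotient.edist_proj_le _ _ _
  -- the map from the leaf space of the glued foliation to the glued leaf space
  let φ : Glued h → GluedHLS F₁ F₂ h := Quotient.lift
    (fun a : M₁ ⊕ M₂ => pr (a.map F₁.toHLS F₂.toHLS)) fun a b hab => by
      refine eq_of_eqvGen (f := fun a : M₁ ⊕ M₂ => pr (a.map F₁.toHLS F₂.toHLS)) ?_ hab
      rintro _ _ ⟨x, rfl, rfl⟩
      exact MetricQuotient.proj_eq_of_rel (Relation.EqvGen.rel _ _ ⟨x, rfl, rfl⟩)
  have hφ_le : ∀ p q, edist (φ p) (φ q) ≤ riemannianEDist (𝓡∂ n) p q :=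
    edist_le_riemannianEDist_of_cover c₁ e₁ hg₁.norm_mfderiv c₂ e₂ hg₂.norm_mfderiv
      (Glued.exists_inl_or_inr h)
      (fun x y => (hpr (Sum.inl (F₁.toHLS x)) (Sum.inl (F₁.toHLS y))).trans (hF₁_le x y))
      (fun x y => (hpr (Sum.inr (F₂.toHLS x)) (Sum.inr (F₂.toHLS y))).trans (hF₂_le x y))
  -- A leaf of `F` is the image of a leaf of whichever piece contains `p`, so `q` is related to `p`
  -- already inside that piece.
  have hφ_leaf : ∀ p q, F.leafSetoid p q → φ p = φ q := by
    intro p q hpq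
    have hq : q ∈ F.leaf p := hpq
    rcases Glued.exists_inl_or_inr h p with ⟨x, rfl⟩ | ⟨x, rfl⟩
    · rw [hF_inl] at hq
      obtain ⟨y, hy, rfl⟩ := hq
      exact congrArg (fun a => pr (Sum.inl a)) (MetricQuotient.proj_eq_of_rel hy)
    · rw [hF_inr] at hq
      obtain ⟨y, hy, rfl⟩ := hq
      exact congrArg (fun a => pr (Sum.inr a)) (MetricQuotient.proj_eq_of_rel hy)
  obtain ⟨Φ, hΦ, hΦ_le⟩ : ∃ Φ : F.HLS → GluedHLS F₁ F₂ h, (∀ p, Φ (F.toHLS p) = φ p) ∧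
      ∀ z w, edist (Φ z) (Φ w) ≤ edist z w :=
    MetricQuotient.exists_lift _ _ _ φ hφ_leaf hφ_le
  -- the inverse map, first on the two pieces
  obtain ⟨Ψ₁, hΨ₁, hΨ₁_le⟩ : ∃ Ψ₁ : F₁.HLS → F.HLS,
      (∀ x, Ψ₁ (F₁.toHLS x) = F.toHLS (Glued.inl h x)) ∧
      ∀ z w, edist (Ψ₁ z) (Ψ₁ w) ≤ edist z w := by
    refine MetricQuotient.exists_lift _ _ _ (fun x => F.toHLS (Glued.inl h x)) (fun x y hxy => ?_)
      fun x y => (hF_le _ _).trans (riemannianEDist_map_le c₁ hg₁.norm_mfderiv x y)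
    have : Glued.inl h y ∈ F.leaf (Glued.inl h x) := hF_inl x ▸ Set.mem_image_of_mem _ hxy
    exact MetricQuotient.proj_eq_of_rel this
  obtain ⟨Ψ₂, hΨ₂, hΨ₂_le⟩ : ∃ Ψ₂ : F₂.HLS → F.HLS,
      (∀ x, Ψ₂ (F₂.toHLS x) = F.toHLS (Glued.inr h x)) ∧
      ∀ z w, edist (Ψ₂ z) (Ψ₂ w) ≤ edist z w := by
    refine MetricQuotient.exists_lift _ _ _ (fun x => F.toHLS (Glued.inr h x)) (fun x y hxy => ?_)
      fun x y => (hF_le _ _).trans (riemannianEDist_map_le c₂ hg₂.norm_mfderiv x y)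
    have : Glued.inr h y ∈ F.leaf (Glued.inr h x) := hF_inr x ▸ Set.mem_image_of_mem _ hxy
    exact MetricQuotient.proj_eq_of_rel this
  obtain ⟨Ψ, hΨ, hΨ_le⟩ : ∃ Ψ : GluedHLS F₁ F₂ h → F.HLS,
      (∀ a, Ψ (pr a) = Sum.elim Ψ₁ Ψ₂ a) ∧ ∀ z w, edist (Ψ z) (Ψ w) ≤ edist z w := by
    refine MetricQuotient.exists_lift _ _ _ (Sum.elim Ψ₁ Ψ₂) (fun a b hab => ?_) ?_
    · refine eq_of_eqvGen ?_ hab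
      rintro _ _ ⟨x, rfl, rfl⟩
      -- The two partial inverses agree on the gluing relation because `x` and `h x` are the same
      -- point of `M`.
      rw [Sum.elim_inl, Sum.elim_inr, hΨ₁, hΨ₂, Glued.inl_eq_inr_iff.2 ⟨x, rfl, rfl⟩]
    · rintro (a | a) (b | b)
      · exact hΨ₁_le a b
      · exact le_top
      · exact le_top
      · exact hΨ₂_le a b
  refine nonempty_isometryEquiv_of_nonexpanding (f := Φ) (g := Ψ) (fun z => ?_) (fun z => ?_)
    hΦ_le hΨ_le
  · obtain ⟨p, rfl⟩ : ∃ p, F.toHLS p = z := MetricQuotient.proj_surjective _ _ _ z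
    rw [hΦ]
    rcases Glued.exists_inl_or_inr h p with ⟨x, rfl⟩ | ⟨x, rfl⟩
    · exact (hΨ (Sum.inl (F₁.toHLS x))).trans (hΨ₁ x)
    · exact (hΨ (Sum.inr (F₂.toHLS x))).trans (hΨ₂ x)
  · obtain ⟨a, rfl⟩ : ∃ a, pr a = z := MetricQuotient.proj_surjective _ _ _ z
    rw [hΨ]
    rcases a with a | a
    · obtain ⟨x, rfl⟩ : ∃ x, F₁.toHLS x = a := MetricQuotient.proj_surjective _ _ _ a
      rw [Sum.elim_inl, hΨ₁, hΦ]; rfl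
    · obtain ⟨x, rfl⟩ : ∃ x, F₂.toHLS x = a := MetricQuotient.proj_surjective _ _ _ a
      rw [Sum.elim_inr, hΨ₂, hΦ]; rfl
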